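/- Consider $n$ grid-forming converters connected by a network with line susceptances $b_{ij}=b_{ji}\ge 0$ (with $b_{ij}=0$ if there is no line), uniform resistance-inductance ratio $\rho\ge 0$ and steady-state voltage magnitudes $|v|_{0,i}>0$. Let $D_0(s)=\mathrm{diag}(D_1(s),\dots,D_n(s))$ with $$D_i(s)=\begin{bmatrix}\frac{d_{p,i}}{\tau_{p,i}s+1}&0\\0&\frac{d_{q,i}}{\tau_{q,i}s+1}\end{bmatrix},\qquad d_{p,i},d_{q,i}>0,\quad \tau_{p,i},\tau_{q,i}\ge 0,$$ and $N_0(s)=N\cdot\mathrm{diag}\big(\tfrac1s,\tfrac1{|v|_{0,1}},\dots,\tfrac1s,\tfrac1{|v|_{0,n}}\big)$, where $N$ is a real $2n\times 2n$ matrix with $2\times 2$ blocks $N_{ij}$. For proper real rational matrices $H_1,H_2$, the negative feedback interconnection $H_1\# H_2$ is called internally feedback stable if $I+H_1H_2$ is invertible as a rational matrix and the four closed-loop transfer matrices $(I+H_1H_2)^{-1}H_1$, $(I+H_1H_2)^{-1}H_1H_2$, $H_2(I+H_1H_2)^{-1}H_1$, $H_2(I+H_1H_2)^{-1}$ are proper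 with all poles in the open left half plane. (1) Quasi-stationary network model: let $$N_{ii}=\sum_{j\ne i}\frac{b_{ij}}{1+\rho^2}\begin{bmatrix}|v|_{0,i}|v|_{0,j}&0\\0&2|v|_{0,i}^2-|v|_{0,i}|v|_{0,j}\end{bmatrix},\qquad N_{ij}=-b_{ij}\frac{|v|_{0,i}|v|_{0,j}}{1+\rho^2}I_2\quad(i\ne j),$$ where the (possibly unequal) per-unit voltages satisfy $0.9\le|v|_{0,i}\le 1.1$ for all $i$. If for each $i\in\{1,\dots,n\}$ $$\alpha_{q,i}:=\frac{d_{q,i}}{|v|_{0,i}}\sum_{j\ne i}b_{ij}<\frac{5(1+\rho^2)}{4}\qquad\text{and}\qquad \tau_{p,i}>0\ \text{ or }\ \tau_{q,i}>0,$$ then $D_0\#N_0$ is internally feedback stable (and $D_0$, $N_0$ are proper). (2) Zero-power-flow network model: let $|v|_{0,i}=|v|_0>0$ for all $i$ and $$N_{ii}=\sum_{j\ne i}b_{ij}\frac{|v|_0^2}{1+\rho^2}I_2,\qquad N_{ij}=-b_{ij}\frac{|v|_0^2}{1+\rho^2}I_2\quad(i\ne j).$$ Then $D_0\#N_0$ is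 internally feedback stable (and $D_0$, $N_0$ are proper), for all $d_{p,i},d_{q,i}>0$ and $\tau_{p,i},\tau_{q,i}\ge0$, without any further condition. -/

import Mathlib

noncomputable section

namespace GridForming

/-! ### Real rational transfer matrices, stability, feedback interconnection -/

/-- A real rational transfer function is proper if the degree of its numerator does not exceed
the degree of its denominator. -/
def IsProper (g : RatFunc ℝ) : Prop :=
  g.num.degree ≤ g.denom.degree

/-- `z` is a pole of `g`: a complex zero of the reduced denominator of `g`. -/
def IsPole (g : RatFunc ℝ) (z : ℂ) : Prop :=
  Polynomial.aeval z g.denom = 0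

/-- A transfer matrix is proper if all its entries are. -/
def IsProperMatrix {ι : Type*} (H : Matrix ι ι (RatFunc ℝ)) : Prop :=
  ∀ i j, IsProper (H i j)

/-- The space `RH_∞` of real rational proper transfer matrices
all of whose poles lie in the open left half plane. -/
def RHInfty (ι : Type*) : Set (Matrix ι ι (RatFunc ℝ)) :=
  {H | IsProperMatrix H ∧ ∀ i j, ∀ z : ℂ, IsPole (H i j) z → z.re < 0}

/-- The closed-loop transfer matrix `H₁ # H₂` of the negative feedback interconnection,
from the inputs `(w₁, w₂)` to the outputs `(y₁, y₂)`, where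
`y₁ = H₁ (w₁ - y₂)` and `y₂ = H₂ (y₁ + w₂)`. -/
def closedLoop {ι : Type*} [Fintype ι] [DecidableEq ι] (H₁ H₂ : Matrix ι ι (RatFunc ℝ)) :
    Matrix (ι ⊕ ι) (ι ⊕ ι) (RatFunc ℝ) :=
  Matrix.fromBlocks
    ((1 + H₁ * H₂)⁻¹ * H₁)        (-((1 + H₁ * H₂)⁻¹ * H₁ * H₂))
    (H₂ * (1 + H₁ * H₂)⁻¹ * H₁)   (H₂ * (1 + H₁ * H₂)⁻¹)

/-- Internal feedback stability of the feedback interconnection of two proper transfer matrices: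
the loop is solvable and all four closed-loop transfer matrices are proper and stable. -/
def InternallyStable {ι : Type*} [Fintype ι] [DecidableEq ι]
    (H₁ H₂ : Matrix ι ι (RatFunc ℝ)) : Prop :=
  IsProperMatrix H₁ ∧ IsProperMatrix H₂ ∧ IsUnit (1 + H₁ * H₂) ∧
    closedLoop H₁ H₂ ∈ RHInfty (ι ⊕ ι)

/-! ### Converter (device) dynamics

Signals are indexed by `Fin n × Fin 2`: `(i, 0)` is the active power / frequency (angle) channel
and `(i, 1)` the reactive power / voltage magnitude channel of node `i`. -/

/-- First-order low-pass filtered droop characteristic `d / (τ s + 1)`. -/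
def droop (d τ : ℝ) : RatFunc ℝ :=
  RatFunc.C d / (RatFunc.C τ * RatFunc.X + 1)

/-- The device dynamics `D₀(s) = diag(D₁(s), …, Dₙ(s))` with
`Dᵢ(s) = diag(d_{p,i} / (τ_{p,i} s + 1), d_{q,i} / (τ_{q,i} s + 1))`. -/
def deviceDynamics {n : ℕ} (dp dq τp τq : Fin n → ℝ) :
    Matrix (Fin n × Fin 2) (Fin n × Fin 2) (RatFunc ℝ) :=
  Matrix.comp (Fin n) (Fin n) (Fin 2) (Fin 2) (RatFunc ℝ)
    (Matrix.diagonal fun i => !![droop (dp i) (τp i), 0; 0, droop (dq i) (τq i)])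

/-! ### Network dynamics -/

/-- The self susceptance `∑_{j ≠ i} b i j` of node `i`. -/
def selfSusceptance {n : ℕ} (b : Fin n → Fin n → ℝ) (i : Fin n) : ℝ :=
  ∑ j with j ≠ i, b i j

/-- The `2 × 2` blocks of the quasi-stationary network model with line susceptances `b`,
resistance-inductance ratio `ρ` and steady-state voltage magnitudes `v`. -/
def quasiStationaryBlock {n : ℕ} (b : Fin n → Fin n → ℝ) (ρ : ℝ) (v : Fin n → ℝ) (i j : Fin n) :
    Matrix (Fin 2) (Fin 2) ℝ :=
  if i = j then
    ∑ k with k ≠ i, (b i k * (1 / (1 + ρ ^ 2))) •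
      !![v i * v k, 0; 0, 2 * v i ^ 2 - v i * v k]
  else
    (b i j * (v i * v j / (1 + ρ ^ 2))) • !![-1, 0; 0, -1]

/-- The `2 × 2` blocks of the zero-power-flow network model, in which all steady-state voltage
magnitudes equal `v₀`. -/
def zeroPowerFlowBlock {n : ℕ} (b : Fin n → Fin n → ℝ) (ρ v₀ : ℝ) (i j : Fin n) :
    Matrix (Fin 2) (Fin 2) ℝ :=
  if i = j then
    ∑ k with k ≠ i, (b i k * (v₀ ^ 2 / (1 + ρ ^ 2))) • !![1, 0; 0, 1]
  else
    (b i j * (v₀ ^ 2 / (1 + ρ ^ 2))) • !![-1, 0; 0, -1]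

/-- The network dynamics `N₀(s) = N(s) · diag(1/s, 1/|v|_{0,1}, …, 1/s, 1/|v|_{0,n})`
for a static network model `N` with the given `2 × 2` blocks. -/
def networkDynamics {n : ℕ} (N : Fin n → Fin n → Matrix (Fin 2) (Fin 2) ℝ) (v : Fin n → ℝ) :
    Matrix (Fin n × Fin 2) (Fin n × Fin 2) (RatFunc ℝ) :=
  Matrix.comp (Fin n) (Fin n) (Fin 2) (Fin 2) (RatFunc ℝ)
      (Matrix.of fun i j => (N i j).map RatFunc.C) *
    Matrix.comp (Fin n) (Fin n) (Fin 2) (Fin 2) (RatFunc ℝ)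
      (Matrix.diagonal fun i => !![1 / RatFunc.X, 0; 0, 1 / RatFunc.C (v i)])

/-- `α_{q,i} = (d_{q,i} / |v|_{0,i}) ∑_{j ≠ i} b i j`. -/
def alphaQ {n : ℕ} (b : Fin n → Fin n → ℝ) (dq v : Fin n → ℝ) (i : Fin n) : ℝ :=
  dq i / v i * selfSusceptance b i

end GridForming

end

/-! Both network models have diagonal `2 × 2` blocks, so the loop splits into an angle channel with
network `L / s` and a voltage channel with network `K diag(1 / v)`. For each channel it suffices to
find a stable proper `T` with `T (1 + D H) = H`: then `(1 + D H)⁻¹ = 1 - D T`, and all four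
closed-loop maps are polynomials in `D` and `T` (`internallyStable_of_mul_eq`).

Such a `T` comes from inverting a matrix over `stableRing`, where an element is a unit as soon as it
vanishes nowhere on the closed right half plane or at infinity. Recording these values next to the
rational function makes evaluation a ring homomorphism, so invertibility is a pointwise kernel
question, answered by passivity.

In the voltage channel the droop values satisfy `|δ|² ≤ d Re δ`, so positivity of `diag(v / d) + K`
excludes a kernel (`eq_zero_of_static_feedback`). In the angle channel the integrator pole is
removed by factoring `L = M Mᵀ` and regularising the kernel (`exists_stable_angle_channel`). What
remains is edgewise: `L` is a weighted Laplacian, and the bound on `alphaQ` pays for the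
indefiniteness of `K`. -/

noncomputable section

namespace GridForming

open Polynomial

/-! ### The ring of stable proper transfer functions, with their boundary values -/

/-- The closed right half plane together with the point at infinity `none`. -/
abbrev ExtendedHalfPlane : Type := Option {z : ℂ // 0 ≤ z.re}

/-- The value of the fraction `p / q` at a point of the extended closed right half plane. -/
def fractionValue (p q : ℝ[X]) : ExtendedHalfPlane → ℂ
  -- For a proper fraction this is the limit at infinity; it is zero when the fraction is strictly
  -- proper.
  | none => (p.coeff q.natDegree / q.leadingCoeff : ℝ)
  | some z => aeval (z : ℂ) p / aeval (z : ℂ) q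

/-- `p / q` is a proper fraction whose denominator has no zeros in the closed right half plane. -/
structure IsStableFraction (p q : ℝ[X]) : Prop where
  natDegree_le : p.natDegree ≤ q.natDegree
  aeval_ne_zero : ∀ z : ℂ, 0 ≤ z.re → aeval z q ≠ 0

namespace IsStableFraction

variable {p q p' q' : ℝ[X]}

theorem ne_zero (h : IsStableFraction p q) : q ≠ 0 := by
  rintro rfl
  exact h.aeval_ne_zero 0 (by simp) (by simp)

theorem algebraMap_ne_zero (h : IsStableFraction p q) : algebraMap ℝ[X] (RatFunc ℝ) q ≠ 0 :=
  RatFunc.algebraMap_ne_zero h.ne_zero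

theorem leadingCoeff_ne_zero (h : IsStableFraction p q) : q.leadingCoeff ≠ 0 :=
  Polynomial.leadingCoeff_ne_zero.2 h.ne_zero

theorem mul (h : IsStableFraction p q) (h' : IsStableFraction p' q') :
    IsStableFraction (p * p') (q * q') where
  natDegree_le := by
    rw [natDegree_mul h.ne_zero h'.ne_zero]
    exact natDegree_mul_le.trans (add_le_add h.natDegree_le h'.natDegree_le)
  aeval_ne_zero z hz := by
    rw [map_mul]
    exact mul_ne_zero (h.aeval_ne_zero z hz) (h'.aeval_ne_zero z hz)

theorem add (h : IsStableFraction p q) (h' : IsStableFraction p' q') :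
    IsStableFraction (p * q' + q * p') (q * q') where
  natDegree_le := by
    rw [natDegree_mul h.ne_zero h'.ne_zero]
    refine natDegree_add_le_of_degree_le ?_ ?_
    · exact natDegree_mul_le.trans (add_le_add h.natDegree_le le_rfl)
    · exact natDegree_mul_le.trans (add_le_add le_rfl h'.natDegree_le)
  aeval_ne_zero := (h.mul h').aeval_ne_zero

theorem neg (h : IsStableFraction p q) : IsStableFraction (-p) q where
  natDegree_le := by simpa using h.natDegree_le
  aeval_ne_zero := h.aeval_ne_zero

theorem const (r : ℝ) : IsStableFraction (C r) 1 where
  natDegree_le := by simp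
  aeval_ne_zero z _ := by simp

/-- At infinity, properness leaves a single product in the coefficient of degree `q.natDegree +
q'.natDegree`. -/
theorem fractionValue_mul (h : IsStableFraction p q) (h' : IsStableFraction p' q') :
    fractionValue (p * p') (q * q') = fractionValue p q * fractionValue p' q' := by
  funext ω
  cases ω with
  | none =>
    simp only [fractionValue, Pi.mul_apply]
    rw [natDegree_mul h.ne_zero h'.ne_zero, leadingCoeff_mul,
      coeff_mul_add_eq_of_natDegree_le h.natDegree_le h'.natDegree_le]
    push_cast
    rw [mul_div_mul_comm]
  | some z =>
    simp only [fractionValue, Pi.mul_apply, map_mul]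
    rw [mul_div_mul_comm]

theorem fractionValue_add (h : IsStableFraction p q) (h' : IsStableFraction p' q') :
    fractionValue (p * q' + q * p') (q * q') = fractionValue p q + fractionValue p' q' := by
  funext ω
  cases ω with
  | none =>
    simp only [fractionValue, Pi.add_apply]
    rw [natDegree_mul h.ne_zero h'.ne_zero, leadingCoeff_mul, coeff_add,
      coeff_mul_add_eq_of_natDegree_le h.natDegree_le le_rfl,
      coeff_mul_add_eq_of_natDegree_le le_rfl h'.natDegree_le, coeff_natDegree, coeff_natDegree,
      ← div_add_div _ _ h.leadingCoeff_ne_zero h'.leadingCoeff_ne_zero]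
    push_cast
    rfl
  | some z =>
    simp only [fractionValue, Pi.add_apply, map_mul, map_add]
    rw [div_add_div _ _ (h.aeval_ne_zero _ z.2) (h'.aeval_ne_zero _ z.2)]

theorem fractionValue_neg : fractionValue (-p) q = -fractionValue p q := by
  funext ω
  cases ω <;> simp [fractionValue, neg_div]

theorem fractionValue_const (r : ℝ) : fractionValue (C r) 1 = fun _ => (r : ℂ) := by
  funext ω
  cases ω <;> simp [fractionValue]

/-- `IsProper` refers to the reduced fraction, so degrees are compared in `num * q = p * denom` and
the degree of `q` is cancelled. -/
theorem isProper (h : IsStableFraction p q) :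
    IsProper (algebraMap ℝ[X] (RatFunc ℝ) p / algebraMap ℝ[X] (RatFunc ℝ) q) := by
  set g := algebraMap ℝ[X] (RatFunc ℝ) p / algebraMap ℝ[X] (RatFunc ℝ) q with hg
  have hmul : g.num * q = p * g.denom := (RatFunc.num_mul_eq_mul_denom_iff h.ne_zero).2 hg
  have hdeg := congrArg degree hmul
  rw [degree_mul, degree_mul] at hdeg
  have hle : p.degree ≤ q.degree := by
    rw [degree_eq_natDegree h.ne_zero]
    exact degree_le_of_natDegree_le h.natDegree_le
  have : g.num.degree + q.degree ≤ g.denom.degree + q.degree := by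
    rw [hdeg, add_comm]
    gcongr
  rw [degree_eq_natDegree h.ne_zero] at this
  exact WithBot.le_of_add_le_add_right (by simp) this

theorem re_neg_of_isPole (h : IsStableFraction p q) {z : ℂ}
    (hz : IsPole (algebraMap ℝ[X] (RatFunc ℝ) p / algebraMap ℝ[X] (RatFunc ℝ) q) z) :
    z.re < 0 := by
  by_contra! hre
  obtain ⟨r, hr⟩ := RatFunc.denom_div_dvd p q
  refine h.aeval_ne_zero z hre ?_
  rw [hr, map_mul, show aeval z (RatFunc.denom _) = 0 from hz, zero_mul]

end IsStableFraction

/-- The ring of proper stable transfer functions, each paired with its values on the extended closed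
right half plane. -/
def stableRing : Subring (RatFunc ℝ × (ExtendedHalfPlane → ℂ)) where
  carrier := {g | ∃ p q, IsStableFraction p q ∧
    g = (algebraMap ℝ[X] (RatFunc ℝ) p / algebraMap ℝ[X] (RatFunc ℝ) q, fractionValue p q)}
  mul_mem' := by
    rintro _ _ ⟨p, q, h, rfl⟩ ⟨p', q', h', rfl⟩
    refine ⟨_, _, h.mul h', ?_⟩
    rw [h.fractionValue_mul h', map_mul, map_mul, mul_div_mul_comm]
    rfl
  one_mem' := ⟨C 1, 1, .const 1, by
    rw [IsStableFraction.fractionValue_const]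
    ext <;> simp⟩
  add_mem' := by
    rintro _ _ ⟨p, q, h, rfl⟩ ⟨p', q', h', rfl⟩
    refine ⟨_, _, h.add h', ?_⟩
    rw [h.fractionValue_add h', map_add, map_mul, map_mul, map_mul,
      ← div_add_div _ _ h.algebraMap_ne_zero h'.algebraMap_ne_zero]
    rfl
  zero_mem' := ⟨C 0, 1, .const 0, by
    rw [IsStableFraction.fractionValue_const]
    ext <;> simp⟩
  neg_mem' := by
    rintro _ ⟨p, q, h, rfl⟩
    refine ⟨_, _, h.neg, ?_⟩
    rw [IsStableFraction.fractionValue_neg, map_neg, neg_div]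
    rfl

namespace stableRing

/-- The underlying transfer function. -/
def toRatFunc : stableRing →+* RatFunc ℝ := (RingHom.fst _ _).comp stableRing.subtype

/-- Evaluation at a point of the extended closed right half plane. -/
def eval (ω : ExtendedHalfPlane) : stableRing →+* ℂ :=
  (Pi.evalRingHom _ ω).comp ((RingHom.snd _ _).comp stableRing.subtype)

/-- The element of the ring given by a stable fraction. -/
def ofFraction {p q : ℝ[X]} (h : IsStableFraction p q) : stableRing :=
  ⟨_, p, q, h, rfl⟩

theorem toRatFunc_ofFraction {p q : ℝ[X]} (h : IsStableFraction p q) :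
    toRatFunc (ofFraction h) =
      algebraMap ℝ[X] (RatFunc ℝ) p / algebraMap ℝ[X] (RatFunc ℝ) q := rfl

theorem eval_ofFraction {p q : ℝ[X]} (h : IsStableFraction p q) (ω : ExtendedHalfPlane) :
    eval ω (ofFraction h) = fractionValue p q ω := rfl

theorem exists_eq_ofFraction (g : stableRing) :
    ∃ (p q : ℝ[X]) (h : IsStableFraction p q), g = ofFraction h := by
  obtain ⟨_, p, q, h, rfl⟩ := g
  exact ⟨p, q, h, rfl⟩

theorem ext_iff' {g g' : stableRing} :
    g = g' ↔ toRatFunc g = toRatFunc g' ∧ ∀ ω, eval ω g = eval ω g' := by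
  refine ⟨fun h => by simp [h], fun h => ?_⟩
  exact Subtype.ext (Prod.ext h.1 (funext h.2))

/-- Constants as stable transfer functions. -/
def const : ℝ →+* stableRing where
  toFun r := ofFraction (.const r)
  map_one' :=
    ext_iff'.2 ⟨by simp [toRatFunc_ofFraction], fun ω => by
      cases ω <;> simp [eval_ofFraction, fractionValue]⟩
  map_zero' :=
    ext_iff'.2 ⟨by simp [toRatFunc_ofFraction], fun ω => by
      cases ω <;> simp [eval_ofFraction, fractionValue]⟩
  map_mul' := fun _ _ =>
    ext_iff'.2 ⟨by simp [toRatFunc_ofFraction], fun ω => by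
      cases ω <;> simp [eval_ofFraction, fractionValue]⟩
  map_add' := fun _ _ =>
    ext_iff'.2 ⟨by simp [toRatFunc_ofFraction], fun ω => by
      cases ω <;> simp [eval_ofFraction, fractionValue]⟩

@[simp] theorem toRatFunc_const (r : ℝ) : toRatFunc (const r) = RatFunc.C r := by
  simp [const, toRatFunc_ofFraction]

@[simp] theorem eval_const (r : ℝ) (ω : ExtendedHalfPlane) : eval ω (const r) = r := by
  simp [const, eval_ofFraction, IsStableFraction.fractionValue_const]

theorem isProper_toRatFunc (g : stableRing) : IsProper (toRatFunc g) := by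
  obtain ⟨p, q, h, rfl⟩ := exists_eq_ofFraction g
  exact h.isProper

theorem re_neg_of_isPole_toRatFunc (g : stableRing) {z : ℂ} (hz : IsPole (toRatFunc g) z) :
    z.re < 0 := by
  obtain ⟨p, q, h, rfl⟩ := exists_eq_ofFraction g
  exact h.re_neg_of_isPole hz

/-- A nonzero value at infinity forces equal degrees and nonzero finite values exclude zeros of `p`,
so `q / p` is again a stable fraction. -/
theorem isUnit_of_eval_ne_zero {g : stableRing} (hg : ∀ ω, eval ω g ≠ 0) : IsUnit g := by
  obtain ⟨p, q, h, rfl⟩ := exists_eq_ofFraction g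
  have hinf : p.coeff q.natDegree ≠ 0 := by
    intro h0
    apply hg none
    simp [eval_ofFraction, fractionValue, h0]
  have hdeg : p.natDegree = q.natDegree := h.natDegree_le.antisymm (le_natDegree_of_ne_zero hinf)
  have hz : ∀ z : ℂ, 0 ≤ z.re → aeval z p ≠ 0 := by
    intro z hz h0
    apply hg (some ⟨z, hz⟩)
    simp [eval_ofFraction, fractionValue, h0]
  have h' : IsStableFraction q p := ⟨hdeg.ge, hz⟩
  refine IsUnit.of_mul_eq_one (ofFraction h') (ext_iff'.2 ⟨?_, fun ω => ?_⟩)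
  · rw [map_mul, toRatFunc_ofFraction, toRatFunc_ofFraction, map_one,
      div_mul_div_cancel₀ h.algebraMap_ne_zero, div_self h'.algebraMap_ne_zero]
  · rw [map_mul, eval_ofFraction, eval_ofFraction, map_one]
    cases ω with
    | none =>
      simp only [fractionValue]
      rw [hdeg, leadingCoeff, leadingCoeff, hdeg, ← Complex.ofReal_mul,
        div_mul_div_cancel₀ (by simpa using h.leadingCoeff_ne_zero), div_self hinf, Complex.ofReal_one]
    | some z =>
      simp only [fractionValue]
      rw [div_mul_div_cancel₀ (h.aeval_ne_zero _ z.2), div_self (hz _ z.2)]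

theorem isUnit_det_of_eval_injective {ι : Type*} [Fintype ι] [DecidableEq ι]
    {A : Matrix ι ι stableRing}
    (hA : ∀ ω (x : ι → ℂ), (A.map (eval ω)).mulVec x = 0 → x = 0) : IsUnit A.det := by
  refine isUnit_of_eval_ne_zero fun ω h0 => ?_
  rw [RingHom.map_det, RingHom.mapMatrix_apply] at h0
  obtain ⟨x, hx, hx0⟩ := Matrix.exists_mulVec_eq_zero_iff.2 h0
  exact hx (hA ω x hx0)

end stableRing

open stableRing

/-- Internal stability follows from a stable `T` playing the role of `H₂ (1 + H₁ H₂)⁻¹`. -/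
theorem internallyStable_of_mul_eq {ι : Type*} [Fintype ι] [DecidableEq ι]
    (D T : Matrix ι ι stableRing) {H : Matrix ι ι (RatFunc ℝ)} (hH : IsProperMatrix H)
    (hT : T.map toRatFunc * (1 + D.map toRatFunc * H) = H) :
    InternallyStable (D.map toRatFunc) H := by
  set D' := D.map toRatFunc with hD'
  set T' := T.map toRatFunc with hT'
  -- Expanding gives `1 + D H - D (T (1 + D H))`, and the last term is `D H`.
  have hleft : (1 - D' * T') * (1 + D' * H) = 1 := by
    rw [sub_mul, one_mul, Matrix.mul_assoc, hT, add_sub_cancel_right]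
  have hright := mul_eq_one_comm.1 hleft
  have hinv : (1 + D' * H)⁻¹ = 1 - D' * T' := Matrix.inv_eq_left_inv hleft
  have hHT : H * (1 + D' * H)⁻¹ = T' := by
    rw [hinv]
    nth_rw 1 [← hT]
    rw [Matrix.mul_assoc, hright, Matrix.mul_one]
  have hDT : (1 + D' * H)⁻¹ * D' * H = D' * T' := by
    have : (1 + D' * H)⁻¹ * (1 + D' * H) = 1 := by rw [hinv, hleft]
    rw [mul_add, mul_one] at this
    rw [Matrix.mul_assoc, eq_sub_of_add_eq' this, hinv, sub_sub_cancel]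
  have hmap : closedLoop D' H = (Matrix.fromBlocks ((1 - D * T) * D) (-(D * T)) (T * D) T).map
      toRatFunc := by
    rw [closedLoop, hHT, hDT, hinv, Matrix.fromBlocks_map]
    simp only [← RingHom.mapMatrix_apply, map_mul, map_sub, map_neg, map_one, hD', hT']
  refine ⟨fun i j => isProper_toRatFunc _, hH, IsUnit.of_mul_eq_one _ hright, ?_⟩
  rw [hmap]
  exact ⟨fun i j => isProper_toRatFunc _, fun i j z hz => re_neg_of_isPole_toRatFunc _ hz⟩

/-! ### Values of the droop characteristics -/

theorem isStableFraction_droop (d : ℝ) {τ : ℝ} (hτ : 0 ≤ τ) :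
    IsStableFraction (C d) (C τ * X + 1) where
  natDegree_le := by simp
  aeval_ne_zero z hz h0 := by
    have h := congrArg Complex.re h0
    simp at h
    nlinarith [mul_nonneg hτ hz]

/-- The droop characteristic as a stable transfer function. -/
def stableDroop (d : ℝ) {τ : ℝ} (hτ : 0 ≤ τ) : stableRing :=
  ofFraction (isStableFraction_droop d hτ)

theorem toRatFunc_stableDroop (d : ℝ) {τ : ℝ} (hτ : 0 ≤ τ) :
    toRatFunc (stableDroop d hτ) = droop d τ := by
  simp [stableDroop, toRatFunc_ofFraction, droop]

theorem eval_none_stableDroop (d : ℝ) {τ : ℝ} (hτ : 0 ≤ τ) :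
    eval none (stableDroop d hτ) = if τ = 0 then (d : ℂ) else 0 := by
  rw [stableDroop, eval_ofFraction, fractionValue]
  split_ifs with h
  · simp [h]
  · have hdeg : (C τ * X + 1 : ℝ[X]).natDegree = 1 := natDegree_linear h
    rw [hdeg, coeff_C_of_ne_zero one_ne_zero]
    simp

theorem eval_some_stableDroop (d : ℝ) {τ : ℝ} (hτ : 0 ≤ τ) (z : {z : ℂ // 0 ≤ z.re}) :
    eval (some z) (stableDroop d hτ) = d / (τ * z + 1) := by
  simp [stableDroop, eval_ofFraction, fractionValue]

/-- The value lies in the disc with diameter `[0, d]`: at finite points with `d > 0` this is `Re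
(1/δ) ≥ 1/d`, where `1/δ = (τ z + 1)/d`. Unlike strict positivity of the real part, the bound also
survives at infinity. -/
theorem normSq_eval_stableDroop_le {d : ℝ} (hd : 0 ≤ d) {τ : ℝ} (hτ : 0 ≤ τ)
    (ω : ExtendedHalfPlane) :
    Complex.normSq (eval ω (stableDroop d hτ)) ≤ d * (eval ω (stableDroop d hτ)).re := by
  cases ω with
  | none =>
    rw [eval_none_stableDroop]
    split_ifs <;> simp
  | some z =>
    rw [eval_some_stableDroop, Complex.normSq_div, Complex.normSq_ofReal, Complex.div_re]
    have h : 0 ≤ τ * (z : ℂ).re := mul_nonneg hτ z.2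
    simp only [Complex.ofReal_re, Complex.ofReal_im, zero_mul, zero_div, add_zero, mul_div_assoc']
    refine div_le_div_of_nonneg_right ?_ (Complex.normSq_nonneg _)
    simp
    nlinarith [mul_nonneg (mul_nonneg hd hd) h]

theorem re_eval_some_stableDroop_pos {d : ℝ} (hd : 0 < d) {τ : ℝ} (hτ : 0 ≤ τ)
    (z : {z : ℂ // 0 ≤ z.re}) : 0 < (eval (some z) (stableDroop d hτ)).re := by
  have h : 0 ≤ τ * (z : ℂ).re := mul_nonneg hτ z.2
  have hre : 0 < (τ * z + 1 : ℂ).re := by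
    simp
    linarith
  have hne : (τ * z + 1 : ℂ) ≠ 0 := fun h0 => by simp [h0] at hre
  rw [eval_some_stableDroop, Complex.div_re]
  simp only [Complex.ofReal_re, Complex.ofReal_im, zero_mul, zero_div, add_zero]
  exact div_pos (mul_pos hd hre) (Complex.normSq_pos.2 hne)

/-! ### The voltage magnitude channel -/

section Channels

variable {ι : Type*} [Fintype ι]

/-- Since `K` is real, products of a real part with an imaginary part contribute nothing to the real
part. -/
theorem re_sum_star_mul (K : Matrix ι ι ℝ) (y : ι → ℂ) :
    (∑ i, star (y i) * ∑ j, (K i j : ℂ) * y j).re =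
      (∑ i, (y i).re * ∑ j, K i j * (y j).re) + ∑ i, (y i).im * ∑ j, K i j * (y j).im := by
  rw [Complex.re_sum, ← Finset.sum_add_distrib]
  refine Finset.sum_congr rfl fun i _ => ?_
  simp [Complex.mul_re]

/-- A strictly passive diagonal device in feedback with a static network is well posed at every point
of the extended closed right half plane. -/
theorem eq_zero_of_static_feedback {K : Matrix ι ι ℝ} {v d : ι → ℝ} {δ : ι → ℂ}
    (hv : ∀ i, 0 < v i) (hd : ∀ i, 0 < d i)
    (hδ : ∀ i, Complex.normSq (δ i) ≤ d i * (δ i).re)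
    (hK : ∀ a : ι → ℝ, a ≠ 0 → 0 < ∑ i, a i * (v i / d i * a i + ∑ j, K i j * a j))
    {y : ι → ℂ} (hy : ∀ i, v i * y i + δ i * ∑ j, (K i j : ℂ) * y j = 0) : y = 0 := by
  set k : ι → ℂ := fun i => ∑ j, (K i j : ℂ) * y j with hk
  -- From `v y = -δ k` follow `v Re(ȳ k) = -(Re δ)|k|²` and `v²|y|² = |δ|²|k|²`; the disc bound on
  -- `δ` compares the two.
  have hterm : ∀ i, v i / d i * Complex.normSq (y i) + (star (y i) * k i).re ≤ 0 := by
    intro i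
    have e : (v i : ℂ) * y i = -(δ i * k i) := eq_neg_of_add_eq_zero_left (hy i)
    have e1 : v i * (star (y i) * k i).re = -((δ i).re * Complex.normSq (k i)) := by
      have hre := congrArg Complex.re e
      have him := congrArg Complex.im e
      simp [Complex.mul_re, Complex.mul_im] at hre him
      simp [Complex.mul_re, Complex.normSq_apply]
      linear_combination (k i).re * hre + (k i).im * him
    have e2 : v i ^ 2 * Complex.normSq (y i) = Complex.normSq (δ i) * Complex.normSq (k i) := by
      have := congrArg Complex.normSq e
      simpa [pow_two] using this
    have h3 : v i ^ 2 * Complex.normSq (y i) ≤ -(d i * (v i * (star (y i) * k i).re)) := by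
      rw [e2, e1]
      have := mul_le_mul_of_nonneg_right (hδ i) (Complex.normSq_nonneg (k i))
      linarith
    have h4 : v i * d i * (v i / d i * Complex.normSq (y i) + (star (y i) * k i).re) ≤ 0 := by
      have : v i * d i * (v i / d i * Complex.normSq (y i)) = v i ^ 2 * Complex.normSq (y i) := by
        field_simp [(hd i).ne']
      rw [mul_add, this]
      linarith
    exact nonpos_of_mul_nonpos_right h4 (mul_pos (hv i) (hd i))
  -- The form in `hK`, taken at the real and imaginary parts of `y`, has nonpositive total, so both
  -- parts vanish.
  have hsum : (∑ i, (y i).re * (v i / d i * (y i).re + ∑ j, K i j * (y j).re)) +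
      ∑ i, (y i).im * (v i / d i * (y i).im + ∑ j, K i j * (y j).im) ≤ 0 := by
    have h := Finset.sum_nonpos fun i (_ : i ∈ Finset.univ) => hterm i
    rw [Finset.sum_add_distrib, ← Complex.re_sum, re_sum_star_mul] at h
    refine le_of_eq_of_le ?_ h
    simp only [mul_add, Finset.sum_add_distrib, Complex.normSq_apply, mul_left_comm _ (v _ / d _)]
    ring
  have hnonneg : ∀ a : ι → ℝ, 0 ≤ ∑ i, a i * (v i / d i * a i + ∑ j, K i j * a j) := by
    intro a
    by_cases ha : a = 0
    · simp [ha]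
    · exact (hK a ha).le
  have hzero : ∀ a : ι → ℝ, ∑ i, a i * (v i / d i * a i + ∑ j, K i j * a j) ≤ 0 → a = 0 :=
    fun a ha => by_contra fun h => (hK a h).not_ge ha
  have hre := hzero (fun i => (y i).re) (by linarith [hnonneg fun i => (y i).im])
  have him := hzero (fun i => (y i).im) (by linarith [hnonneg fun i => (y i).re])
  funext i
  exact Complex.ext (congrFun hre i) (congrFun him i)

/-- The network is static and hence already in the ring, so `T = N (1 + D N)⁻¹` works once `1 + D N`
is invertible there. -/
theorem exists_stable_voltage_channel [DecidableEq ι] {K : Matrix ι ι ℝ} {v d τ : ι → ℝ}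
    (hv : ∀ i, 0 < v i) (hd : ∀ i, 0 < d i) (hτ : ∀ i, 0 ≤ τ i)
    (hK : ∀ a : ι → ℝ, a ≠ 0 → 0 < ∑ i, a i * (v i / d i * a i + ∑ j, K i j * a j)) :
    ∃ T : Matrix ι ι stableRing,
      T.map toRatFunc * (1 + (Matrix.diagonal fun i => droop (d i) (τ i)) *
        (K.map RatFunc.C * Matrix.diagonal fun i => 1 / RatFunc.C (v i))) =
      K.map RatFunc.C * Matrix.diagonal fun i => 1 / RatFunc.C (v i) := by
  set D : Matrix ι ι stableRing := Matrix.diagonal fun i => stableDroop (d i) (hτ i) with hD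
  set N : Matrix ι ι stableRing := K.map const * Matrix.diagonal fun i => const (v i)⁻¹ with hN
  have hDmap : D.map toRatFunc = Matrix.diagonal fun i => droop (d i) (τ i) := by
    rw [hD, Matrix.diagonal_map (map_zero _)]
    simp [toRatFunc_stableDroop]
  have hNmap : N.map toRatFunc = K.map RatFunc.C * Matrix.diagonal fun i => 1 / RatFunc.C (v i) := by
    rw [hN, Matrix.map_mul, Matrix.diagonal_map (map_zero _), Matrix.map_map]
    congr 1
    · ext i j
      simp
    · simp
  have hunit : IsUnit (1 + D * N).det := by
    refine isUnit_det_of_eval_injective fun ω x hx => ?_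
    -- The substitution `y = x / v` turns the kernel equation into `v y + δ K y = 0`.
    have hy : (fun i => ((v i)⁻¹ : ℂ) * x i) = 0 := by
      refine eq_zero_of_static_feedback (K := K) (δ := fun i => eval ω (stableDroop (d i) (hτ i)))
        hv hd (fun i => normSq_eval_stableDroop_le (hd i).le (hτ i) ω) hK fun i => ?_
      have h := congrFun hx i
      have hmap : (1 + D * N).map (eval ω) = 1 +
          (Matrix.diagonal fun i => eval ω (stableDroop (d i) (hτ i))) *
            (K.map (fun r => (r : ℂ)) * Matrix.diagonal fun i => ((v i)⁻¹ : ℂ)) := by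
        simp only [← RingHom.mapMatrix_apply, map_add, map_mul, map_one, hD, hN]
        congr 2
        · simp [Matrix.diagonal_map]
        · congr 1
          · ext i j
            simp
          · simp [Matrix.diagonal_map]
      rw [hmap, Matrix.add_mulVec, Matrix.one_mulVec, ← Matrix.mulVec_mulVec,
        ← Matrix.mulVec_mulVec] at h
      have hvi : (v i : ℂ) ≠ 0 := Complex.ofReal_ne_zero.2 (hv i).ne'
      simp only [Pi.add_apply, Matrix.mulVec_diagonal, Pi.zero_apply] at h
      rw [mul_inv_cancel_left₀ hvi]
      rw [← h]
      congr 2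
      simp [Matrix.mulVec, dotProduct, Matrix.diagonal_apply]
    funext i
    have h := congrFun hy i
    simpa [(hv i).ne'] using h
  refine ⟨N * (1 + D * N)⁻¹, ?_⟩
  rw [← hDmap, ← hNmap]
  simp only [← RingHom.mapMatrix_apply]
  rw [← map_mul, ← map_one (toRatFunc.mapMatrix), ← map_add, ← map_mul, Matrix.mul_assoc,
    Matrix.nonsing_inv_mul _ hunit, Matrix.mul_one]

end Channels

/-! ### The angle channel -/

section Channels

variable {ι : Type*} [Fintype ι] [DecidableEq ι]

/-- A positive semidefinite real matrix factors as `M * Mᵀ` with orthogonal columns. -/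
theorem exists_factorization_of_posSemidef {L : Matrix ι ι ℝ} (hL : L.PosSemidef) :
    ∃ (M : Matrix ι ι ℝ) (μ : ι → ℝ), (∀ i, 0 ≤ μ i) ∧ M * M.transpose = L ∧
      M.transpose * M = Matrix.diagonal μ := by
  set U : Matrix ι ι ℝ := (hL.isHermitian.eigenvectorUnitary).1 with hU
  set μ := hL.isHermitian.eigenvalues with hμ
  have hUU : U.transpose * U = 1 := by
    have := Unitary.coe_star_mul_self hL.isHermitian.eigenvectorUnitary
    rwa [Matrix.star_eq_conjTranspose, Matrix.conjTranspose_eq_transpose_of_trivial] at this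
  have hspec : L = U * Matrix.diagonal μ * U.transpose := by
    have := hL.isHermitian.spectral_theorem
    rw [Unitary.conjStarAlgAut_apply, Matrix.star_eq_conjTranspose,
      Matrix.conjTranspose_eq_transpose_of_trivial] at this
    simpa using this
  have hsq : (Matrix.diagonal fun i => √(μ i)) * (Matrix.diagonal fun i => √(μ i)) =
      Matrix.diagonal μ := by
    rw [Matrix.diagonal_mul_diagonal]
    congr 1
    funext i
    exact Real.mul_self_sqrt (hL.eigenvalues_nonneg i)
  refine ⟨U * Matrix.diagonal fun i => √(μ i), μ, hL.eigenvalues_nonneg, ?_, ?_⟩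
  · rw [Matrix.transpose_mul, Matrix.diagonal_transpose, Matrix.mul_assoc,
      ← Matrix.mul_assoc (Matrix.diagonal _), hsq, ← Matrix.mul_assoc]
    exact hspec.symm
  · rw [Matrix.transpose_mul, Matrix.diagonal_transpose, Matrix.mul_assoc,
      ← Matrix.mul_assoc U.transpose, hUU, Matrix.one_mul, hsq]

/-- A passive diagonal device in feedback with an integrating network is well posed, once the kernel
of the network is regularised. -/
theorem eq_zero_of_integrating_feedback {M : Matrix ι ι ℝ} {μ : ι → ℝ} {δ : ι → ℂ} {w : ℂ}
    (hM : M.transpose * M = Matrix.diagonal μ)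
    (hδ : w = 0 ∨ ∃ z : ℂ, 0 ≤ z.re ∧ 1 - w = w * z ∧ w ≠ 0 ∧ ∀ i, 0 < (δ i).re) {x : ι → ℂ}
    (hx : ∀ i, (1 - w) * x i + w * ((∑ k, (M k i : ℂ) * (δ k * ∑ j, (M k j : ℂ) * x j)) +
      if μ i = 0 then x i else 0) = 0) : x = 0 := by
  -- The case `w = 0` is the point at infinity. At a finite point `w = 1/(z + 1)`, and dividing by
  -- `w` leaves the coefficient `z`.
  obtain rfl | ⟨z, hz, hwz, hw, hδ⟩ := hδ
  · funext i
    simpa using hx i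
  set y : ι → ℂ := fun k => ∑ j, (M k j : ℂ) * x j with hy
  have hx' : ∀ i, z * x i + ((∑ k, (M k i : ℂ) * (δ k * y k)) + if μ i = 0 then x i else 0) = 0 := by
    intro i
    have h := hx i
    rw [hwz, mul_assoc, ← mul_add] at h
    exact (mul_eq_zero.1 h).resolve_left hw
  have hnormSq : ∀ a c : ℂ, (star a * (c * a)).re = c.re * Complex.normSq a := by
    intro a c
    simp [Complex.mul_re, Complex.mul_im, Complex.normSq_apply]
    ring
  -- Pairing with `x` gives three terms with nonnegative real parts, from `z`, from `δ` acting on `y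
  -- = M x`, and from the regularisation; each real part therefore vanishes.
  have henergy : ∑ i, star (x i) *
      (z * x i + ((∑ k, (M k i : ℂ) * (δ k * y k)) + if μ i = 0 then x i else 0)) = 0 :=
    Finset.sum_eq_zero fun i _ => by rw [hx' i, mul_zero]
  have hcross : ∑ i, star (x i) * ∑ k, (M k i : ℂ) * (δ k * y k) =
      ∑ k, star (y k) * (δ k * y k) := by
    simp only [Finset.mul_sum]
    rw [Finset.sum_comm]
    refine Finset.sum_congr rfl fun k _ => ?_
    rw [hy]
    simp only [star_sum, star_mul', Finset.sum_mul]
    refine Finset.sum_congr rfl fun i _ => ?_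
    simp
    ring
  simp only [mul_add, Finset.sum_add_distrib] at henergy
  rw [hcross] at henergy
  have hre := congrArg Complex.re henergy
  simp only [Complex.add_re, Complex.re_sum, hnormSq, Complex.zero_re] at hre
  have h1 : 0 ≤ ∑ i, z.re * Complex.normSq (x i) :=
    Finset.sum_nonneg fun i _ => mul_nonneg hz (Complex.normSq_nonneg _)
  have h2 : ∀ i ∈ Finset.univ, 0 ≤ (δ i).re * Complex.normSq (y i) :=
    fun i _ => mul_nonneg (hδ i).le (Complex.normSq_nonneg _)
  have h3 : ∀ i ∈ Finset.univ, 0 ≤ (star (x i) * if μ i = 0 then x i else 0).re := by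
    intro i _
    split_ifs
    · simpa [hnormSq] using (hnormSq (x i) 1).ge.trans' (by simpa using Complex.normSq_nonneg _)
    · simp
  have h2' := Finset.sum_nonneg h2
  have h3' := Finset.sum_nonneg h3
  have hy0 : ∀ k, y k = 0 := by
    intro k
    have h := (Finset.sum_eq_zero_iff_of_nonneg h2).1 (by linarith) k (Finset.mem_univ k)
    exact Complex.normSq_eq_zero.1 ((mul_eq_zero.1 h).resolve_left (hδ k).ne')
  -- `M x = 0` gives `Mᵀ M x = μ x = 0`; coordinates with `μ i = 0` are left to the regularising
  -- term.
  have hμx : ∀ i, (μ i : ℂ) * x i = 0 := by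
    intro i
    have h : ∑ k, (M k i : ℂ) * y k = ∑ j, ((M.transpose * M) i j : ℂ) * x j := by
      simp only [hy, Finset.mul_sum, Matrix.mul_apply, Matrix.transpose_apply, Complex.ofReal_sum,
        Complex.ofReal_mul, Finset.sum_mul]
      rw [Finset.sum_comm]
      simp only [mul_assoc]
    rw [hM] at h
    simpa [hy0, Matrix.diagonal_apply, apply_ite] using h.symm
  funext i
  by_cases hi : μ i = 0
  · have h := (Finset.sum_eq_zero_iff_of_nonneg h3).1 (by linarith) i (Finset.mem_univ i)
    rw [if_pos hi] at h
    have h' := hnormSq (x i) 1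
    rw [one_mul, h] at h'
    exact Complex.normSq_eq_zero.1 (by simpa using h'.symm)
  · exact (mul_eq_zero.1 (hμx i)).resolve_left (Complex.ofReal_ne_zero.2 hi)

/-- With `w = 1/(s + 1)`, take `T = w M A⁻¹ Mᵀ` for `A = (1 - w) + w (Mᵀ D M + Q)`. At `s = 0` the
matrix `Mᵀ D M` alone is singular on the kernel of `M`; the projection `Q` repairs this and drops
out of `T` because `Q Mᵀ = 0`. -/
theorem exists_stable_angle_channel {L : Matrix ι ι ℝ} (hL : L.PosSemidef) {d τ : ι → ℝ}
    (hd : ∀ i, 0 < d i) (hτ : ∀ i, 0 ≤ τ i) :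
    ∃ T : Matrix ι ι stableRing,
      T.map toRatFunc * (1 + (Matrix.diagonal fun i => droop (d i) (τ i)) *
        (L.map RatFunc.C * Matrix.diagonal fun _ => 1 / RatFunc.X)) =
      L.map RatFunc.C * Matrix.diagonal fun _ => 1 / RatFunc.X := by
  obtain ⟨M, μ, hμ, hMM, hM⟩ := exists_factorization_of_posSemidef hL
  set w : stableRing := stableDroop 1 zero_le_one with hw
  set D : Matrix ι ι stableRing := Matrix.diagonal fun i => stableDroop (d i) (hτ i) with hD
  set N : Matrix ι ι stableRing := M.map const with hN
  set Q : Matrix ι ι stableRing := Matrix.diagonal fun i => if μ i = 0 then 1 else 0 with hQ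
  set A : Matrix ι ι stableRing := (1 - w) • 1 + w • (N.transpose * D * N + Q) with hA
  have hunit : IsUnit A.det := by
    refine isUnit_det_of_eval_injective fun ω x hx => ?_
    refine eq_zero_of_integrating_feedback (M := M) (μ := μ)
      (δ := fun i => eval ω (stableDroop (d i) (hτ i))) (w := eval ω w) hM ?_ fun i => ?_
    · cases ω with
      | none => exact .inl (by simp [hw, eval_none_stableDroop])
      | some z =>
        have hz : (z + 1 : ℂ) ≠ 0 := by
          intro h0
          have := congrArg Complex.re h0
          simp at this
          linarith [z.2]
        refine .inr ⟨z, z.2, ?_, ?_, fun i => re_eval_some_stableDroop_pos (hd i) (hτ i) z⟩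
        · rw [hw, eval_some_stableDroop]
          simp only [Complex.ofReal_one, one_mul]
          field_simp
          ring
        · rw [hw, eval_some_stableDroop]
          simpa using hz
    · have h := congrFun hx i
      have hmap : A.map (eval ω) = (1 - eval ω w) • 1 + eval ω w •
          ((M.map (fun r => (r : ℂ))).transpose *
            ((Matrix.diagonal fun i => eval ω (stableDroop (d i) (hτ i))) *
            M.map (fun r => (r : ℂ))) + Matrix.diagonal fun i => if μ i = 0 then 1 else 0) := by
        have h1 : N.map (eval ω) = M.map (fun r => (r : ℂ)) := by
          ext i j
          simp [hN]
        have h2 : D.map (eval ω) =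
            Matrix.diagonal fun i => eval ω (stableDroop (d i) (hτ i)) := by
          rw [hD, Matrix.diagonal_map (map_zero _)]
        have h3 : Q.map (eval ω) = Matrix.diagonal fun i => if μ i = 0 then 1 else 0 := by
          rw [hQ, Matrix.diagonal_map (map_zero _)]
          simp [apply_ite]
        rw [hA, ← h1, ← h2, ← h3, Matrix.mul_assoc]
        simp only [← RingHom.mapMatrix_apply, Matrix.smul_eq_diagonal_mul,
          map_add, map_mul, map_one]
        simp [Matrix.diagonal_map, Matrix.transpose_map]
      rw [hmap, Matrix.add_mulVec, Matrix.smul_mulVec, Matrix.one_mulVec, Matrix.smul_mulVec,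
        Matrix.add_mulVec, ← Matrix.mulVec_mulVec, ← Matrix.mulVec_mulVec] at h
      refine Eq.trans ?_ h
      simp only [Pi.add_apply, Pi.smul_apply, smul_eq_mul, Matrix.mulVec_diagonal, ite_mul, one_mul,
        zero_mul]
      simp [Matrix.mulVec, dotProduct, Matrix.diagonal_apply]
  -- If `μ i = 0`, column `i` of `M` has norm zero.
  have hNQ : Q * N.transpose = 0 := by
    refine Matrix.ext fun i k => ?_
    rw [hQ, Matrix.diagonal_mul]
    split_ifs with hi
    · have h : ∑ k, M k i * M k i = 0 := by
        have := congrFun (congrFun hM i) i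
        simpa [Matrix.mul_apply, hi] using this
      have h' := (Finset.sum_eq_zero_iff_of_nonneg fun k _ => mul_self_nonneg (M k i)).1 h k
        (Finset.mem_univ k)
      simp [hN, mul_self_eq_zero.1 h']
    · simp
  have hwX : toRatFunc w = 1 / (RatFunc.X + 1) := by
    rw [hw, toRatFunc_stableDroop, droop]
    simp
  have hX1 : (RatFunc.X + 1 : RatFunc ℝ) ≠ 0 := by
    have : (X + C 1 : ℝ[X]) ≠ 0 := X_add_C_ne_zero 1
    simpa using RatFunc.algebraMap_ne_zero this
  have hX : (RatFunc.X : RatFunc ℝ) ≠ 0 := RatFunc.X_ne_zero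
  set D' := D.map toRatFunc with hD'
  set N' := N.map toRatFunc with hN'
  have hDmap : D' = Matrix.diagonal fun i => droop (d i) (τ i) := by
    rw [hD', hD, Matrix.diagonal_map (map_zero _)]
    simp [toRatFunc_stableDroop]
  have hLmap : L.map RatFunc.C = N' * N'.transpose := by
    have : N' = M.map RatFunc.C := by
      ext i j
      simp [hN', hN]
    rw [this, ← Matrix.transpose_map, ← Matrix.map_mul, hMM]
  have hint : (Matrix.diagonal fun _ => 1 / RatFunc.X : Matrix ι ι (RatFunc ℝ)) =
      (1 / RatFunc.X : RatFunc ℝ) • 1 := Matrix.smul_one_eq_diagonal _ |>.symm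
  -- Push-through identity: `A Mᵀ = s/(s + 1) · Mᵀ (1 + D L/s)`, using `1 - w = s/(s + 1)`.
  have hAN : A.map toRatFunc * N'.transpose = (RatFunc.X / (RatFunc.X + 1) : RatFunc ℝ) •
      (N'.transpose * (1 + D' * ((N' * N'.transpose) * ((1 / RatFunc.X : RatFunc ℝ) • 1)))) := by
    have h : A * N.transpose = (1 - w) • N.transpose + w • (N.transpose * D * N * N.transpose) := by
      rw [hA, add_mul, Matrix.smul_mul, Matrix.one_mul, Matrix.smul_mul, Matrix.add_mul, hNQ,
        add_zero]
    have h' := congrArg toRatFunc.mapMatrix h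
    simp only [Matrix.smul_eq_diagonal_mul, map_add, map_mul] at h'
    simp only [RingHom.mapMatrix_apply, Matrix.diagonal_map (map_zero toRatFunc)] at h'
    simp only [← Matrix.smul_eq_diagonal_mul, map_sub, map_one, hwX, Matrix.transpose_map] at h'
    rw [hN', h', ← hN', ← hD']
    simp only [Matrix.mul_smul, Matrix.mul_add, Matrix.mul_one, smul_add, smul_smul,
      Matrix.mul_assoc]
    congr 2
    · field_simp
      ring
    · field_simp
  refine ⟨w • (N * A⁻¹ * N.transpose), ?_⟩
  have hT : (w • (N * A⁻¹ * N.transpose)).map toRatFunc =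
      (1 / (RatFunc.X + 1) : RatFunc ℝ) • (N' * A⁻¹.map toRatFunc * N'.transpose) := by
    rw [← hwX]
    ext i j
    simp [hN', Matrix.mul_apply]
  have hAA : A⁻¹.map toRatFunc * A.map toRatFunc = 1 := by
    simp only [← RingHom.mapMatrix_apply]
    rw [← map_mul, Matrix.nonsing_inv_mul _ hunit, map_one]
  rw [← hDmap, hLmap, hint, hT]
  set B := 1 + D' * ((N' * N'.transpose) * ((1 / RatFunc.X : RatFunc ℝ) • 1)) with hB
  have hNB : N'.transpose * B = ((RatFunc.X + 1) / RatFunc.X : RatFunc ℝ) •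
      (A.map toRatFunc * N'.transpose) := by
    rw [hAN, smul_smul, div_mul_div_cancel₀ hX, div_self hX1, one_smul]
  rw [Matrix.smul_mul, Matrix.mul_assoc, hNB, Matrix.mul_smul, smul_smul, Matrix.mul_assoc,
    ← Matrix.mul_assoc _ (A.map _), hAA, Matrix.one_mul, Matrix.mul_smul, Matrix.mul_one]
  congr 1
  field_simp

end Channels

/-! ### Quadratic forms of network matrices -/

section Network

variable {ι : Type*} [Fintype ι] [DecidableEq ι]

/-- The matrix with diagonal entries `∑ k ≠ i, g i k` and off-diagonal entries `-h i j`. -/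
def edgeMatrix (g h : ι → ι → ℝ) : Matrix ι ι ℝ :=
  Matrix.of fun i j => if i = j then ∑ k with k ≠ i, g i k else -h i j

/-- Each edge occurs in both orientations, so only its symmetrised contribution needs a sign. -/
theorem sum_ne_nonneg {f : ι → ι → ℝ} (hf : ∀ i j, i ≠ j → 0 ≤ f i j + f j i) :
    0 ≤ ∑ i, ∑ j with j ≠ i, f i j := by
  simp only [Finset.sum_filter]
  have hswap : ∑ i, ∑ j, (if j ≠ i then f i j else 0) = ∑ i, ∑ j, if i ≠ j then f j i else 0 :=
    Finset.sum_comm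
  have h : 0 ≤ (∑ i, ∑ j, if j ≠ i then f i j else 0) + ∑ i, ∑ j, if i ≠ j then f j i else 0 := by
    simp only [← Finset.sum_add_distrib]
    refine Finset.sum_nonneg fun i _ => Finset.sum_nonneg fun j _ => ?_
    by_cases hij : i = j
    · simp [hij]
    · simpa [hij, Ne.symm hij] using hf i j hij
  linarith

theorem sum_mul_edgeMatrix (g h : ι → ι → ℝ) (a : ι → ℝ) (i : ι) :
    a i * ∑ j, edgeMatrix g h i j * a j =
      ∑ j with j ≠ i, (g i j * a i ^ 2 - h i j * a i * a j) := by
  have hsplit : ∑ j, edgeMatrix g h i j * a j =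
      (∑ k with k ≠ i, g i k) * a i + ∑ j with j ≠ i, -h i j * a j := by
    rw [← Finset.sum_filter_add_sum_filter_not Finset.univ (fun j => j ≠ i), add_comm]
    congr 1
    · simp [Finset.filter_eq', edgeMatrix]
    · refine Finset.sum_congr rfl fun j hj => ?_
      rw [edgeMatrix, Matrix.of_apply, if_neg (Ne.symm (Finset.mem_filter.1 hj).2)]
  rw [hsplit, mul_add, Finset.sum_mul, Finset.mul_sum, Finset.mul_sum, ← Finset.sum_add_distrib]
  refine Finset.sum_congr rfl fun j _ => ?_
  ring

/-- This is a weighted graph Laplacian: an edge contributes `w i j * (a i - a j) ^ 2`. -/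
theorem posSemidef_edgeMatrix {w : ι → ι → ℝ} (hsymm : ∀ i j, w i j = w j i)
    (hw : ∀ i j, i ≠ j → 0 ≤ w i j) : (edgeMatrix w w).PosSemidef := by
  refine Matrix.PosSemidef.of_dotProduct_mulVec_nonneg ?_ fun a => ?_
  · ext i j
    by_cases hij : i = j
    · simp [edgeMatrix, hij]
    · simp [edgeMatrix, hij, Ne.symm hij, hsymm i j]
  · simp only [star_trivial, dotProduct, Matrix.mulVec]
    simp only [sum_mul_edgeMatrix]
    refine sum_ne_nonneg fun i j hij => ?_
    rw [hsymm j i]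
    nlinarith [mul_nonneg (hw i j hij) (sq_nonneg (a i - a j))]

end Network

/-! ### Assembling the two channels -/

variable {n : ℕ}

/-- `Matrix.blockDiagonal` takes the second coordinate as block index, so its blocks are channels
rather than nodes. -/
theorem deviceDynamics_eq (dp dq τp τq : Fin n → ℝ) :
    deviceDynamics dp dq τp τq = Matrix.blockDiagonal
      ![Matrix.diagonal fun i => droop (dp i) (τp i),
        Matrix.diagonal fun i => droop (dq i) (τq i)] := by
  ext ⟨i, a⟩ ⟨j, c⟩
  rw [deviceDynamics, Matrix.comp_apply, Matrix.blockDiagonal_apply]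
  by_cases hij : i = j
  · subst hij
    fin_cases a <;> fin_cases c <;> simp
  · fin_cases a <;> fin_cases c <;> simp [hij]

theorem networkDynamics_eq {N : Fin n → Fin n → Matrix (Fin 2) (Fin 2) ℝ}
    {L K : Matrix (Fin n) (Fin n) ℝ} (hN : ∀ i j, N i j = !![L i j, 0; 0, K i j]) (v : Fin n → ℝ) :
    networkDynamics N v = Matrix.blockDiagonal
      ![L.map RatFunc.C * Matrix.diagonal fun _ => 1 / RatFunc.X,
        K.map RatFunc.C * Matrix.diagonal fun i => 1 / RatFunc.C (v i)] := by
  have h1 : Matrix.comp (Fin n) (Fin n) (Fin 2) (Fin 2) (RatFunc ℝ)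
      (Matrix.of fun i j => (N i j).map RatFunc.C) =
        Matrix.blockDiagonal ![L.map RatFunc.C, K.map RatFunc.C] := by
    ext ⟨i, a⟩ ⟨j, c⟩
    rw [Matrix.comp_apply, Matrix.blockDiagonal_apply, Matrix.of_apply, hN]
    fin_cases a <;> fin_cases c <;> simp
  have h2 : Matrix.comp (Fin n) (Fin n) (Fin 2) (Fin 2) (RatFunc ℝ)
      (Matrix.diagonal fun i => !![1 / RatFunc.X, 0; 0, 1 / RatFunc.C (v i)]) =
        Matrix.blockDiagonal ![Matrix.diagonal fun _ => 1 / RatFunc.X,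
          Matrix.diagonal fun i => 1 / RatFunc.C (v i)] := by
    ext ⟨i, a⟩ ⟨j, c⟩
    rw [Matrix.comp_apply, Matrix.blockDiagonal_apply]
    by_cases hij : i = j
    · subst hij
      fin_cases a <;> fin_cases c <;> simp
    · fin_cases a <;> fin_cases c <;> simp [hij]
  rw [networkDynamics, h1, h2, ← Matrix.blockDiagonal_mul]
  congr 1
  funext k
  fin_cases k <;> rfl

theorem isProper_zero : IsProper 0 := by
  simp [IsProper]

/-- The integrator has a pole at the origin, so its properness cannot come from `stableRing`. -/
theorem isProper_const_mul_inv_X (r : ℝ) : IsProper (RatFunc.C r * (1 / RatFunc.X)) := by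
  by_cases hr : r = 0
  · simpa [hr] using isProper_zero
  set g : RatFunc ℝ := RatFunc.C r * (1 / RatFunc.X) with hg
  have hmul : g.num * Polynomial.X = Polynomial.C r * g.denom := by
    refine (RatFunc.num_mul_eq_mul_denom_iff Polynomial.X_ne_zero).2 ?_
    simp [hg, div_eq_mul_inv]
  have hdeg := congrArg Polynomial.degree hmul
  rw [Polynomial.degree_mul, Polynomial.degree_mul, Polynomial.degree_C hr, Polynomial.degree_X,
    zero_add] at hdeg
  rw [IsProper, ← hdeg]
  exact le_add_of_nonneg_right zero_le_one

theorem isProperMatrix_network (L K : Matrix (Fin n) (Fin n) ℝ) (v : Fin n → ℝ) :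
    IsProperMatrix (ι := Fin n × Fin 2) (Matrix.blockDiagonal
      ![L.map RatFunc.C * Matrix.diagonal fun _ => 1 / RatFunc.X,
        K.map RatFunc.C * Matrix.diagonal fun i => 1 / RatFunc.C (v i)]) := by
  intro ⟨i, a⟩ ⟨j, c⟩
  rw [Matrix.blockDiagonal_apply]
  dsimp only
  split_ifs with hac
  · fin_cases a
    · simpa using isProper_const_mul_inv_X (L i j)
    · have := isProper_toRatFunc (const (K i j * (v j)⁻¹))
      simpa using this
  · exact isProper_zero

/-- Decentralised stability for decoupled angle and voltage channels: the angle network matrix is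
positive semidefinite, and the voltage network matrix is positive definite after adding `v / d`. -/
theorem internallyStable_of_decoupled {dp dq τp τq : Fin n → ℝ}
    (hdp : ∀ i, 0 < dp i) (hdq : ∀ i, 0 < dq i) (hτp : ∀ i, 0 ≤ τp i) (hτq : ∀ i, 0 ≤ τq i)
    {N : Fin n → Fin n → Matrix (Fin 2) (Fin 2) ℝ} {L K : Matrix (Fin n) (Fin n) ℝ}
    (hN : ∀ i j, N i j = !![L i j, 0; 0, K i j]) (hL : L.PosSemidef)
    {v : Fin n → ℝ} (hv : ∀ i, 0 < v i)
    (hK : ∀ a : Fin n → ℝ, a ≠ 0 → 0 < ∑ i, a i * (v i / dq i * a i + ∑ j, K i j * a j)) :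
    InternallyStable (deviceDynamics dp dq τp τq) (networkDynamics N v) := by
  obtain ⟨Tp, hTp⟩ := exists_stable_angle_channel hL hdp hτp
  obtain ⟨Tq, hTq⟩ := exists_stable_voltage_channel hv hdq hτq hK
  have hD : deviceDynamics dp dq τp τq = (Matrix.blockDiagonal
      ![Matrix.diagonal fun i => stableDroop (dp i) (hτp i),
        Matrix.diagonal fun i => stableDroop (dq i) (hτq i)]).map toRatFunc := by
    rw [deviceDynamics_eq, Matrix.blockDiagonal_map _ _ (map_zero _)]
    congr 1
    funext k
    fin_cases k <;>
      simp [Matrix.diagonal_map, toRatFunc_stableDroop]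
  have hdev := hD.symm.trans (deviceDynamics_eq dp dq τp τq)
  rw [hD, networkDynamics_eq hN]
  refine internallyStable_of_mul_eq _ (Matrix.blockDiagonal ![Tp, Tq])
    (isProperMatrix_network L K v) ?_
  rw [hdev, Matrix.blockDiagonal_map _ _ (map_zero _), ← Matrix.blockDiagonal_mul,
    ← Matrix.blockDiagonal_one, ← Matrix.blockDiagonal_add, ← Matrix.blockDiagonal_mul]
  congr 1
  funext k
  fin_cases k
  · exact hTp
  · exact hTq

/-- Per line, the voltage form of the quasi-stationary model is bounded below when voltage magnitudes
deviate from `1` by at most ten percent. -/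
theorem quasiStationary_line_nonneg {v w : ℝ} (hv : 9 / 10 ≤ v ∧ v ≤ 11 / 10)
    (hw : 9 / 10 ≤ w ∧ w ≤ 11 / 10) (a c : ℝ) :
    0 ≤ (2 * v ^ 2 - v * w + 4 / 5) * a ^ 2 + (2 * w ^ 2 - w * v + 4 / 5) * c ^ 2 -
      2 * (v * w) * (a * c) := by
  obtain ⟨hv1, hv2⟩ := hv
  obtain ⟨hw1, hw2⟩ := hw
  -- On the box `2 v (w - v) ≤ 0.36`, so `4 / 5` leaves slack. These bounds give diagonal dominance,
  -- and the rest is the square `v w (a - c)²`.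
  have h1 : v * w ≤ 2 * v ^ 2 - v * w + 4 / 5 := by nlinarith
  have h2 : v * w ≤ 2 * w ^ 2 - w * v + 4 / 5 := by nlinarith
  have h0 : 0 ≤ v * w := by positivity
  nlinarith [mul_nonneg (sub_nonneg.2 h1) (sq_nonneg a), mul_nonneg (sub_nonneg.2 h2) (sq_nonneg c),
    mul_nonneg h0 (sq_nonneg (a - c))]

end GridForming

end

/-! ### The two network models -/

theorem corollary1 (n : ℕ)
    (b : Fin n → Fin n → ℝ) (hb_symm : ∀ i j, b i j = b j i) (hb_nonneg : ∀ i j, i ≠ j → 0 ≤ b i j)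
    (ρ : ℝ) (hρ : 0 ≤ ρ)
    (dp dq τp τq : Fin n → ℝ)
    (hdp : ∀ i, 0 < dp i) (hdq : ∀ i, 0 < dq i)
    (hτp : ∀ i, 0 ≤ τp i) (hτq : ∀ i, 0 ≤ τq i) :
    (∀ v : Fin n → ℝ, (∀ i, 9 / 10 ≤ v i ∧ v i ≤ 11 / 10) →
      (∀ i, GridForming.alphaQ b dq v i < 5 * (1 + ρ ^ 2) / 4 ∧ (0 < τp i ∨ 0 < τq i)) →
      GridForming.InternallyStable
        (GridForming.deviceDynamics dp dq τp τq)
        (GridForming.networkDynamics (GridForming.quasiStationaryBlock b ρ v) v)) ∧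
    (∀ v₀ : ℝ, 0 < v₀ →
      GridForming.InternallyStable
        (GridForming.deviceDynamics dp dq τp τq)
        (GridForming.networkDynamics (GridForming.zeroPowerFlowBlock b ρ v₀) fun _ => v₀)) := by
  have hρ' : 0 < 1 + ρ ^ 2 := by positivity
  constructor
  · intro v hv hα
    have hvpos : ∀ i, 0 < v i := fun i => by linarith [(hv i).1]
    refine GridForming.internallyStable_of_decoupled hdp hdq hτp hτq
      (L := GridForming.edgeMatrix (fun i j => b i j * (1 / (1 + ρ ^ 2)) * (v i * v j))
        (fun i j => b i j * (1 / (1 + ρ ^ 2)) * (v i * v j)))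
      (K := GridForming.edgeMatrix
        (fun i j => b i j * (1 / (1 + ρ ^ 2)) * (2 * v i ^ 2 - v i * v j))
        (fun i j => b i j * (1 / (1 + ρ ^ 2)) * (v i * v j)))
      (fun i j => ?_) (GridForming.posSemidef_edgeMatrix ?_ ?_) hvpos fun a ha => ?_
    · rw [GridForming.quasiStationaryBlock]
      by_cases hij : i = j
      · rw [if_pos hij]
        ext k l
        fin_cases k <;> fin_cases l <;> simp [GridForming.edgeMatrix, hij, Matrix.sum_apply]
      · rw [if_neg hij]
        ext k l
        fin_cases k <;> fin_cases l <;> simp [GridForming.edgeMatrix, hij] <;> ring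
    · intro i j
      rw [hb_symm i j, mul_comm (v i)]
    · intro i j hij
      have := hb_nonneg i j hij
      have := hvpos i
      have := hvpos j
      positivity
    · simp only [mul_add, GridForming.sum_mul_edgeMatrix, Finset.sum_add_distrib]
      -- Each line borrows `4 / 5` of its weight at both ends to make its form nonnegative.
      have hline : 0 ≤ ∑ i, ∑ j with j ≠ i, b i j * (1 / (1 + ρ ^ 2)) *
          ((2 * v i ^ 2 - v i * v j + 4 / 5) * a i ^ 2 - v i * v j * (a i * a j)) := by
        refine GridForming.sum_ne_nonneg fun i j hij => ?_
        rw [hb_symm j i, ← mul_add]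
        have h1 := hb_nonneg i j hij
        refine mul_nonneg (by positivity) ?_
        linarith [GridForming.quasiStationary_line_nonneg (hv i) (hv j) (a i) (a j)]
      -- The borrowed amount is repaid by `v / dq`: the bound on `alphaQ` says exactly that `v / dq`
      -- exceeds `4 / 5` of the scaled self susceptance.
      have hgain : 0 < ∑ i, (v i / dq i - 4 / 5 * (1 / (1 + ρ ^ 2)) *
          GridForming.selfSusceptance b i) * a i ^ 2 := by
        have hcoef : ∀ i, 0 < v i / dq i - 4 / 5 * (1 / (1 + ρ ^ 2)) *
            GridForming.selfSusceptance b i := by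
          intro i
          have h := (hα i).1
          rw [GridForming.alphaQ, div_mul_eq_mul_div, div_lt_iff₀ (hvpos i)] at h
          rw [sub_pos, lt_div_iff₀ (hdq i), mul_one_div, div_mul_eq_mul_div, div_mul_eq_mul_div,
            div_lt_iff₀ hρ']
          linarith
        obtain ⟨i, hi⟩ := Function.ne_iff.1 ha
        refine Finset.sum_pos' (fun j _ => mul_nonneg (hcoef j).le (sq_nonneg _))
          ⟨i, Finset.mem_univ i, mul_pos (hcoef i) (sq_pos_of_ne_zero hi)⟩
      refine (add_pos_of_pos_of_nonneg hgain hline).trans_eq ?_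
      rw [← Finset.sum_add_distrib, ← Finset.sum_add_distrib]
      refine Finset.sum_congr rfl fun i _ => ?_
      rw [GridForming.selfSusceptance, sub_mul, sub_add_eq_add_sub, add_sub_assoc, Finset.mul_sum,
        Finset.sum_mul, ← Finset.sum_sub_distrib]
      congr 1
      · ring
      · refine Finset.sum_congr rfl fun j _ => ?_
        ring
  · intro v₀ hv₀
    have hL : (GridForming.edgeMatrix (fun i j => b i j * (v₀ ^ 2 / (1 + ρ ^ 2)))
        (fun i j => b i j * (v₀ ^ 2 / (1 + ρ ^ 2)))).PosSemidef := by
      refine GridForming.posSemidef_edgeMatrix (fun i j => by rw [hb_symm i j]) fun i j hij => ?_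
      have := hb_nonneg i j hij
      positivity
    refine GridForming.internallyStable_of_decoupled hdp hdq hτp hτq (fun i j => ?_) hL
      (fun _ => hv₀) (K := GridForming.edgeMatrix (fun i j => b i j * (v₀ ^ 2 / (1 + ρ ^ 2)))
        (fun i j => b i j * (v₀ ^ 2 / (1 + ρ ^ 2)))) fun a ha => ?_
    · rw [GridForming.zeroPowerFlowBlock]
      by_cases hij : i = j
      · rw [if_pos hij]
        ext k l
        fin_cases k <;> fin_cases l <;> simp [GridForming.edgeMatrix, hij, Matrix.sum_apply]
      · rw [if_neg hij]
        ext k l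
        fin_cases k <;> fin_cases l <;> simp [GridForming.edgeMatrix, hij]
    -- Here `K` is the same Laplacian as `L`, so adding the positive diagonal `v₀ / dq` already
    -- gives definiteness.
    · simp only [mul_add, Finset.sum_add_distrib]
      have h := hL.dotProduct_mulVec_nonneg a
      simp only [star_trivial, dotProduct, Matrix.mulVec] at h
      refine add_pos_of_pos_of_nonneg ?_ h
      obtain ⟨i, hi⟩ := Function.ne_iff.1 ha
      have hterm : ∀ j, a j * (v₀ / dq j * a j) = v₀ / dq j * a j ^ 2 := fun j => by ring
      simp only [hterm]
      exact Finset.sum_pos' (fun j _ => mul_nonneg (div_pos hv₀ (hdq j)).le (sq_nonneg _))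
        ⟨i, Finset.mem_univ i, mul_pos (div_pos hv₀ (hdq i)) (sq_pos_of_ne_zero hi)⟩
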